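/- For a finite group $G$, call a subgroup $H \le G$ non-self-normalizing if $N_G(H) \ne H$. Let $n \ge 5$ be an integer and let $G$ be a finite solvable group with exactly $n$ conjugacy classes (under conjugation in $G$) of nontrivial non-self-normalizing subgroups. Then the derived length of $G$ (the least $k \ge 0$ such that the $k$-th term $G^{(k)}$ of the derived series of $G$ is trivial) is at most $n-2$. -/

import Mathlib

open scoped Pointwise

/-- The set of nontrivial subgroups of `G` that are not self-normalizing. -/
def nontrivialNonSelfNormalizing (G : Type*) [Group G] : Set (Subgroup G) :=
  {H | H ≠ ⊥ ∧ Subgroup.normalizer (H : Set G) ≠ H}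

/-- The number of `G`-conjugacy classes of nontrivial, non-self-normalizing subgroups of `G`
(for `G` finite). The conjugacy class of a subgroup is its orbit under conjugation. -/
noncomputable def numNonSelfNormalizingClasses (G : Type*) [Group G] : ℕ :=
  ((fun H : Subgroup G => MulAction.orbit (ConjAct G) H) ''
    nontrivialNonSelfNormalizing G).ncard

/-- The family of finite groups with exactly `n` conjugacy classes of nontrivial,
non-self-normalizing subgroups. -/
def FamilyD (n : ℕ) (G : Type*) [Group G] : Prop :=
  Finite G ∧ numNonSelfNormalizingClasses G = n

/-- The derived length of a solvable group: the least `k` with `G⁽ᵏ⁾ = 1`. -/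
noncomputable def derivedLength (G : Type*) [Group G] : ℕ :=
  sInf {k : ℕ | derivedSeries G k = ⊥}

/-! The contrapositive is a lower bound: a solvable group of derived length d ≥ 4 has at least d + 2
classes.

Pass to the quotient by the last nontrivial derived term N, which has derived length d - 1.
Preimages of its classes stay non-conjugate and non-self-normalizing, and N itself is a new class,
so each unit of derived length costs one class. Whenever some nontrivial non-self-normalizing
subgroup fails to contain N, the gain is two (`HasNonSelfNormalizingClasses.of_quotient`).

Derived length 3 already forces four classes (`four_classes_of_derivedSeries`): G', G'' and two
further subgroups, found by cases on the order of G''. The step from 3 to 4 gains two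
(`exists_mem_not_le_of_derivedSeries`): otherwise G' would be a p-group with a unique subgroup of
order p, hence metabelian, and G''' would be trivial. So length 4 gives six classes, and induction
gives d + 2. -/

/-- `G` has `k` pairwise non-conjugate nontrivial non-self-normalizing subgroups. -/
def HasNonSelfNormalizingClasses (G : Type*) [Group G] (k : ℕ) : Prop :=
  ∃ l : List (Subgroup G), l.length = k ∧ (∀ H ∈ l, H ∈ nontrivialNonSelfNormalizing G) ∧
    l.Pairwise fun H K => MulAction.orbit (ConjAct G) H ≠ MulAction.orbit (ConjAct G) K

/-! ### Counting classes: membership and non-conjugacy criteria, passage to quotients. -/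

section Basic

variable {G : Type*} [Group G]

theorem HasNonSelfNormalizingClasses.le_num [Finite G] {k : ℕ}
    (h : HasNonSelfNormalizingClasses G k) : k ≤ numNonSelfNormalizingClasses G := by
  classical
  obtain ⟨l, rfl, hl, hp⟩ := h
  have hnd : (l.map fun H => MulAction.orbit (ConjAct G) H).Nodup := by
    rw [List.Nodup, List.pairwise_map]; exact hp
  have h1 : ((l.map fun H => MulAction.orbit (ConjAct G) H).toFinset :
      Set (Set (Subgroup G))).ncard = l.length := by
    rw [Set.ncard_coe_finset, List.toFinset_card_of_nodup hnd, List.length_map]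
  rw [← h1]
  refine Set.ncard_le_ncard ?_ (Set.toFinite _)
  intro S hS
  simp only [List.coe_toFinset, List.mem_map, Set.mem_ofPred_eq] at hS
  obtain ⟨H, hH, rfl⟩ := hS
  exact ⟨H, hl H hH, rfl⟩

theorem exists_smul_of_orbit_eq {H K : Subgroup G}
    (h : MulAction.orbit (ConjAct G) H = MulAction.orbit (ConjAct G) K) :
    ∃ g : ConjAct G, g • H = K := by
  rw [eq_comm, MulAction.orbit_eq_iff] at h
  exact h

theorem conjAct_smul_eq_of_normal (N : Subgroup G) [N.Normal] (g : ConjAct G) : g • N = N := by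
  exact Subgroup.conjAct_pointwise_smul_eq_self (g := ConjAct.ofConjAct g)
    (by rw [Subgroup.normalizer_eq_top]; trivial)

theorem orbit_ne_of_card_ne {H K : Subgroup G} (h : Nat.card H ≠ Nat.card K) :
    MulAction.orbit (ConjAct G) H ≠ MulAction.orbit (ConjAct G) K := by
  intro he
  obtain ⟨g, rfl⟩ := exists_smul_of_orbit_eq he
  exact h (Nat.card_congr (Subgroup.equivSMul g H).toEquiv)

theorem orbit_ne_of_normal_le {N H K : Subgroup G} [N.Normal] (hH : ¬ N ≤ H) (hK : N ≤ K) :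
    MulAction.orbit (ConjAct G) H ≠ MulAction.orbit (ConjAct G) K := by
  intro he
  obtain ⟨g, rfl⟩ := exists_smul_of_orbit_eq he.symm
  apply hH
  have h2 := Subgroup.pointwise_smul_le_pointwise_smul_iff (a := g) |>.2 hK
  rwa [conjAct_smul_eq_of_normal] at h2

theorem mem_of_normal {H : Subgroup G} [H.Normal] (h1 : H ≠ ⊥) (h2 : H ≠ ⊤) :
    H ∈ nontrivialNonSelfNormalizing G :=
  ⟨h1, by rw [Subgroup.normalizer_eq_top]; exact h2.symm⟩

theorem mem_of_not_le {H K : Subgroup G} (h1 : H ≠ ⊥) (h2 : ¬ K ≤ H)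
    (h3 : K ≤ Subgroup.normalizer (H : Set G)) : H ∈ nontrivialNonSelfNormalizing G :=
  ⟨h1, fun h => h2 (h ▸ h3)⟩

theorem le_normalizer_of_forall_commute {H K : Subgroup G}
    (h : ∀ k ∈ K, ∀ x ∈ H, k * x = x * k) : K ≤ Subgroup.normalizer (H : Set G) := by
  rw [Subgroup.le_normalizer_iff]
  intro k hk x hx
  rw [h k hk x hx, mul_inv_cancel_right]; exact hx

theorem normalizer_of_commutator_le {H M : Subgroup G} (hHM : H ≤ M) (h : ⁅M, M⁆ ≤ H) :
    M ≤ Subgroup.normalizer (H : Set G) := by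
  rw [Subgroup.le_normalizer_iff]
  intro k hk x hx
  have h1 : k * x * k⁻¹ * x⁻¹ ∈ H := h (Subgroup.commutator_mem_commutator hk (hHM hx))
  simpa using H.mul_mem h1 hx

/-- Preimages under the projection commute with normalizers and reflect conjugacy. They contain N
strictly, so N is a further class. As N is normal, a subgroup not containing N is conjugate to none
that does, which gives the second extra class. -/
theorem HasNonSelfNormalizingClasses.of_quotient {N : Subgroup G} [N.Normal] {k : ℕ}
    (h : HasNonSelfNormalizingClasses (G ⧸ N) k) (h1 : N ≠ ⊥) (h2 : N ≠ ⊤) :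
    HasNonSelfNormalizingClasses G (k + 1) ∧
    ((∃ H ∈ nontrivialNonSelfNormalizing G, ¬ N ≤ H) →
      HasNonSelfNormalizingClasses G (k + 2)) := by
  obtain ⟨l, rfl, hl, hp⟩ := h
  have hs := QuotientGroup.mk'_surjective N
  set c : Subgroup (G ⧸ N) → Subgroup G := fun H => H.comap (QuotientGroup.mk' N) with hc
  have hNc : ∀ H, N ≤ c H := fun H => QuotientGroup.le_comap_mk' N H
  have hcN : ∀ H ∈ l, ¬ c H ≤ N := by
    intro H hH hle
    apply (hl H hH).1
    rw [← Subgroup.map_comap_eq_self_of_surjective hs H, Subgroup.map_eq_bot_iff,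
      QuotientGroup.ker_mk']
    exact hle
  have hlc : ∀ H ∈ l, c H ∈ nontrivialNonSelfNormalizing G := by
    intro H hH
    refine ⟨fun h => hcN H hH (h ▸ bot_le), fun h => (hl H hH).2 ?_⟩
    have := Subgroup.comap_normalizer_eq_of_surjective H hs
    apply Subgroup.comap_injective hs
    rw [this]; exact h
  have hpc : (l.map c).Pairwise fun H K =>
      MulAction.orbit (ConjAct G) H ≠ MulAction.orbit (ConjAct G) K := by
    rw [List.pairwise_map]
    refine hp.imp ?_
    intro H K hHK he
    obtain ⟨g, hg⟩ := exists_smul_of_orbit_eq he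
    apply hHK
    rw [eq_comm, MulAction.orbit_eq_iff]
    refine ⟨ConjAct.toConjAct (QuotientGroup.mk' N (ConjAct.ofConjAct g)), ?_⟩
    have h3 : K = (c K).map (QuotientGroup.mk' N) :=
      (Subgroup.map_comap_eq_self_of_surjective hs K).symm
    have h4 : H = (c H).map (QuotientGroup.mk' N) :=
      (Subgroup.map_comap_eq_self_of_surjective hs H).symm
    rw [h3, ← hg]
    conv_lhs => rw [h4]
    ext x
    simp only [Subgroup.mem_map, Subgroup.mem_smul_pointwise_iff_exists]
    constructor
    · rintro ⟨_, ⟨y, hy, rfl⟩, rfl⟩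
      exact ⟨g • y, ⟨y, hy, rfl⟩, by simp [ConjAct.smul_def]⟩
    · rintro ⟨_, ⟨y, hy, rfl⟩, rfl⟩
      exact ⟨_, ⟨y, hy, rfl⟩, by simp [ConjAct.smul_def]⟩
  have hN : ∀ K ∈ l.map c, MulAction.orbit (ConjAct G) N ≠ MulAction.orbit (ConjAct G) K := by
    intro K hK he
    obtain ⟨H, hH, rfl⟩ := List.mem_map.1 hK
    obtain ⟨g, hg⟩ := exists_smul_of_orbit_eq he
    rw [conjAct_smul_eq_of_normal] at hg
    exact hcN H hH hg.ge
  have hall : ∀ H ∈ N :: l.map c, H ∈ nontrivialNonSelfNormalizing G := by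
    intro H hH
    rcases List.mem_cons.1 hH with rfl | hH
    · exact mem_of_normal h1 h2
    · obtain ⟨K, hK, rfl⟩ := List.mem_map.1 hH
      exact hlc K hK
  refine ⟨⟨N :: l.map c, by simp, hall, List.pairwise_cons.2 ⟨hN, hpc⟩⟩, ?_⟩
  rintro ⟨B, hB, hNB⟩
  refine ⟨B :: N :: l.map c, by simp, ?_,
    List.pairwise_cons.2 ⟨?_, List.pairwise_cons.2 ⟨hN, hpc⟩⟩⟩
  · intro H hH
    rcases List.mem_cons.1 hH with rfl | hH
    · exact hB
    · exact hall H hH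
  · intro K hK
    refine orbit_ne_of_normal_le hNB ?_
    rcases List.mem_cons.1 hK with rfl | hK
    · exact le_rfl
    · obtain ⟨H, hH, rfl⟩ := List.mem_map.1 hK
      exact hNc H

/-- Orders separate every pair except C and D, which in one application have equal order and differ
only as orbits. -/
theorem HasNonSelfNormalizingClasses.four {A B C D : Subgroup G}
    (hA : A ∈ nontrivialNonSelfNormalizing G) (hB : B ∈ nontrivialNonSelfNormalizing G)
    (hC : C ∈ nontrivialNonSelfNormalizing G) (hD : D ∈ nontrivialNonSelfNormalizing G)
    (hAB : Nat.card A ≠ Nat.card B) (hAC : Nat.card A ≠ Nat.card C)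
    (hBC : Nat.card B ≠ Nat.card C) (hAD : Nat.card A ≠ Nat.card D)
    (hBD : Nat.card B ≠ Nat.card D)
    (hCD : MulAction.orbit (ConjAct G) C ≠ MulAction.orbit (ConjAct G) D) :
    HasNonSelfNormalizingClasses G 4 := by
  refine ⟨[A, B, C, D], rfl, by simp [hA, hB, hC, hD], ?_⟩
  simp [orbit_ne_of_card_ne, *]

end Basic

/-! ### Finite p-groups: self-centralizing abelian subgroups, unique subgroup of order p, order p³.
-/

section PGroups

variable {G : Type*} [Group G]

/-- A cyclic group has abelian automorphism group, so the conjugation action on N kills commutators.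
-/
theorem commutator_le_centralizer_of_isCyclic (N : Subgroup G) [N.Normal] [IsCyclic N] :
    commutator G ≤ Subgroup.centralizer (N : Set G) := by
  let e := IsCyclic.mulAutMulEquiv N
  have h := Abelianization.commutator_subset_ker (e.toMonoidHom.comp (MulAut.conjNormal (H := N)))
  intro g hg
  have h1 : MulAut.conjNormal (H := N) g = 1 := by
    have := h hg
    rw [MonoidHom.mem_ker] at this
    apply e.injective
    rw [map_one]; exact this
  rw [Subgroup.mem_centralizer_iff]
  intro n hn
  have h2 := congrArg Subtype.val (DFunLike.congr_fun h1 ⟨n, hn⟩)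
  rw [MulAut.conjNormal_apply, MulAut.one_apply] at h2
  exact (mul_inv_eq_iff_eq_mul.1 h2).symm

theorem IsPGroup.inf_center_ne_bot [Finite G] {p : ℕ} [Fact p.Prime] (hG : IsPGroup p G)
    {K : Subgroup G} [K.Normal] (hK : K ≠ ⊥) : K ⊓ Subgroup.center G ≠ ⊥ := by
  have hG' : IsPGroup p (ConjAct G) := hG
  have hdvd : p ∣ Nat.card K := by
    rcases (hG.to_subgroup K).card_eq_or_dvd with h | h
    · exact absurd (Subgroup.card_eq_one.1 h) hK
    · exact h
  have h1 : (1 : K) ∈ MulAction.fixedPoints (ConjAct G) K := by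
    intro g; simp
  obtain ⟨b, hb, hne⟩ := hG'.exists_fixed_point_of_prime_dvd_card_of_fixed_point K hdvd h1
  rw [Subgroup.ne_bot_iff_exists_ne_one]
  refine ⟨⟨b, b.2, ?_⟩, ?_⟩
  · refine Subgroup.mem_center_iff.2 fun g => ?_
    have h2 := congrArg Subtype.val (hb (ConjAct.toConjAct g))
    rw [ConjAct.Subgroup.val_conj_smul, ConjAct.smul_def, ConjAct.ofConjAct_toConjAct] at h2
    exact mul_inv_eq_iff_eq_mul.1 h2
  · intro h
    apply hne
    have := congrArg Subtype.val h
    exact Subtype.ext this.symm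

theorem sup_zpowers_le_centralizer {A : Subgroup G} {c : G}
    (hA : ∀ x ∈ A, ∀ y ∈ A, x * y = y * x) (hc : ∀ a ∈ A, a * c = c * a) :
    A ⊔ Subgroup.zpowers c ≤ Subgroup.centralizer (A ⊔ Subgroup.zpowers c : Subgroup G) := by
  have h1 : A ⊔ Subgroup.zpowers c ≤ Subgroup.centralizer (A : Set G) := by
    rw [sup_le_iff, Subgroup.zpowers_le]
    exact ⟨fun x hx => Subgroup.mem_centralizer_iff.2 fun y hy => hA y hy x hx,
      Subgroup.mem_centralizer_iff.2 hc⟩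
  have h2 : A ⊔ Subgroup.zpowers c ≤ Subgroup.centralizer (Subgroup.zpowers c : Set G) := by
    rw [sup_le_iff]
    constructor
    · rw [Subgroup.le_centralizer_iff, Subgroup.zpowers_le]
      exact Subgroup.mem_centralizer_iff.2 hc
    · rw [Subgroup.zpowers_le, Subgroup.mem_centralizer_iff]
      rintro _ ⟨i, rfl⟩
      exact ((Commute.refl c).zpow_left i).eq
  rw [sup_le_iff, Subgroup.zpowers_le]
  rw [Subgroup.le_centralizer_iff] at h1 h2
  exact ⟨h1, h2 (Subgroup.mem_zpowers c)⟩

/-- A maximal abelian normal subgroup of a finite `p`-group is self-centralizing. -/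
theorem IsPGroup.exists_self_centralizing [Finite G] {p : ℕ} [Fact p.Prime] (hG : IsPGroup p G) :
    ∃ A : Subgroup G, A.Normal ∧ (∀ x ∈ A, ∀ y ∈ A, x * y = y * x) ∧
      Subgroup.centralizer (A : Set G) ≤ A := by
  obtain ⟨A, hA⟩ := (Set.toFinite {A : Subgroup G | A.Normal ∧
    ∀ x ∈ A, ∀ y ∈ A, x * y = y * x}).exists_maximal ⟨⊥, inferInstance, by simp⟩
  obtain ⟨⟨hAn, hAc⟩, hmax⟩ := hA
  refine ⟨A, hAn, hAc, ?_⟩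
  -- Otherwise C/A meets the center of G/A nontrivially; adjoining to A a lift c of such an element
  -- gives a larger abelian normal subgroup.
  by_contra hle
  set C := Subgroup.centralizer (A : Set G) with hC
  have hCn : C.Normal := inferInstance
  have hq : IsPGroup p (G ⧸ A) := hG.to_quotient A
  have hs := QuotientGroup.mk'_surjective A
  have hm : (C.map (QuotientGroup.mk' A)).Normal := hCn.map _ hs
  have hne : C.map (QuotientGroup.mk' A) ≠ ⊥ := by
    rw [Ne, Subgroup.map_eq_bot_iff, QuotientGroup.ker_mk']; exact hle
  have := hq.inf_center_ne_bot hne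
  rw [Subgroup.ne_bot_iff_exists_ne_one] at this
  obtain ⟨⟨_, ⟨c, hc, rfl⟩, hz⟩, h1⟩ := this
  have hcA : c ∉ A := by
    intro h
    apply h1
    exact Subtype.ext ((QuotientGroup.eq_one_iff c).2 h)
  have hcc : ∀ a ∈ A, a * c = c * a := fun a ha => Subgroup.mem_centralizer_iff.1 hc a ha
  set B := A ⊔ Subgroup.zpowers c with hB
  have hBn : B.Normal := by
    constructor
    intro x hx g
    have h2 : (QuotientGroup.mk' A) (g * x * g⁻¹) = QuotientGroup.mk' A x := by
      have hx' : QuotientGroup.mk' A x ∈ Subgroup.center (G ⧸ A) := by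
        have : B ≤ (Subgroup.center (G ⧸ A)).comap (QuotientGroup.mk' A) := by
          rw [hB, sup_le_iff, Subgroup.zpowers_le]
          exact ⟨QuotientGroup.le_comap_mk' A _, hz⟩
        exact this hx
      rw [map_mul, map_mul, Subgroup.mem_center_iff.1 hx', map_inv, mul_inv_cancel_right]
    have h3 : x⁻¹ * (g * x * g⁻¹) ∈ A := by
      rw [← QuotientGroup.eq]; exact h2.symm
    have := B.mul_mem hx ((le_sup_left : A ≤ B) h3)
    simpa using this
  have hBc : ∀ x ∈ B, ∀ y ∈ B, x * y = y * x := by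
    have h4 := sup_zpowers_le_centralizer hAc hcc
    intro x hx y hy
    exact (Subgroup.mem_centralizer_iff.1 (h4 hx) y hy).symm
  have := hmax (y := B) ⟨hBn, hBc⟩ le_sup_left
  exact hcA (this (le_sup_right (a := A) (Subgroup.mem_zpowers c)))

/-- A maximal cyclic subgroup ⟨a⟩ is everything. By induction on the exponent, x ^ p = a ^ j. If p ∣
j, dividing x by a p-th root of a ^ j in ⟨a⟩ leaves an element of order 1 or p, which lies in ⟨a⟩ by
uniqueness. If p ∤ j, then a ∈ ⟨x⟩ and maximality applies. -/
theorem isCyclic_of_unique_order_prime [Finite G] {p : ℕ} [hp : Fact p.Prime] (hG : IsPGroup p G)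
    (hc : ∀ x y : G, x * y = y * x)
    (h : ∀ x y : G, orderOf x = p → orderOf y = p → x ∈ Subgroup.zpowers y) : IsCyclic G := by
  obtain ⟨C, hC⟩ := (Set.toFinite (Set.range fun a : G => Subgroup.zpowers a)).exists_maximal
    ⟨_, 1, rfl⟩
  obtain ⟨⟨a, rfl⟩, hmax⟩ := hC
  have key : ∀ k : ℕ, ∀ x : G, x ^ p ^ k = 1 → x ∈ Subgroup.zpowers a := by
    intro k
    induction k with
    | zero => intro x hx; rw [pow_zero, pow_one] at hx; rw [hx]; exact one_mem _
    | succ k ih =>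
      intro x hx
      have h1 : x ^ p ∈ Subgroup.zpowers a := ih _ (by rw [← pow_mul, ← pow_succ', hx])
      obtain ⟨j, hj⟩ := Subgroup.mem_zpowers_iff.1 h1
      by_cases hpj : (p : ℤ) ∣ j
      · obtain ⟨i, rfl⟩ := hpj
        set y := x * (a ^ i)⁻¹ with hy
        have hyp : y ^ p = 1 := by
          have : Commute x (a ^ i)⁻¹ := hc _ _
          rw [hy, this.mul_pow, ← hj, inv_pow, ← zpow_natCast (a ^ i), ← zpow_mul, mul_comm i,
            mul_inv_cancel]
        have hx' : x = y * a ^ i := by simp [hy]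
        rw [hx']
        refine mul_mem ?_ (Subgroup.zpow_mem _ (Subgroup.mem_zpowers a) i)
        by_cases hy1 : y = 1
        · rw [hy1]; exact one_mem _
        have hyo := orderOf_eq_prime hyp hy1
        by_cases ha : a = 1
        · have h2 : Subgroup.zpowers a ≤ Subgroup.zpowers y := by
            rw [ha, Subgroup.zpowers_one_eq_bot]; exact bot_le
          exact hmax ⟨y, rfl⟩ h2 (Subgroup.mem_zpowers y)
        · obtain ⟨m, hm⟩ : p ∣ orderOf a := hG.dvd_orderOf ha
          have hm0 : m ≠ 0 := by
            rintro rfl; rw [mul_zero] at hm; exact (orderOf_pos a).ne' hm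
          have h2 : orderOf (a ^ m) = p := by
            rw [orderOf_pow_of_dvd hm0 ⟨p, by rw [hm, mul_comm]⟩, hm,
              Nat.mul_div_cancel _ (Nat.pos_of_ne_zero hm0)]
          exact Subgroup.zpowers_le.2 (Subgroup.npow_mem_zpowers a m) (h y _ hyo h2)
      · have hcop : IsCoprime (p : ℤ) j :=
          (Nat.prime_iff_prime_int.1 hp.out).coprime_iff_not_dvd.2 hpj
        have hcop' : IsCoprime ((orderOf a : ℕ) : ℤ) j := by
          obtain ⟨n, hn⟩ := IsPGroup.iff_orderOf.1 hG a
          rw [hn]; push_cast; exact hcop.pow_left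
        obtain ⟨u, v, huv⟩ := hcop'
        have h3 : a ∈ Subgroup.zpowers x := by
          have : a = (x ^ p) ^ v := by
            conv_lhs => rw [← zpow_one a, ← huv, zpow_add, mul_comm u, zpow_mul, zpow_natCast,
              pow_orderOf_eq_one, one_zpow, one_mul, mul_comm v, zpow_mul, hj]
          rw [this]
          exact Subgroup.zpow_mem _ (Subgroup.npow_mem_zpowers x p) v
        exact hmax ⟨x, rfl⟩ (Subgroup.zpowers_le.2 h3) (Subgroup.mem_zpowers x)
  refine ⟨a, fun x => ?_⟩
  obtain ⟨k, hk⟩ := hG x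
  exact key k x hk

/-- A self-centralizing abelian normal subgroup A is cyclic by uniqueness, so the derived subgroup
centralizes A, hence lies in A and is abelian. -/
theorem IsPGroup.commutator_comm_of_unique_order_prime [Finite G] {p : ℕ} [Fact p.Prime]
    (hG : IsPGroup p G)
    (h : ∀ x y : G, orderOf x = p → orderOf y = p → x ∈ Subgroup.zpowers y) :
    ⁅commutator G, commutator G⁆ = ⊥ := by
  obtain ⟨A, hAn, hAc, hCA⟩ := hG.exists_self_centralizing
  have : IsCyclic A := by
    refine isCyclic_of_unique_order_prime (hG.to_subgroup A)
      (fun x y => Subtype.ext (hAc x x.2 y y.2)) ?_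
    intro x y hx hy
    rw [← Subgroup.orderOf_coe] at hx hy
    obtain ⟨i, hi⟩ := Subgroup.mem_zpowers_iff.1 (h _ _ hx hy)
    exact Subgroup.mem_zpowers_iff.2 ⟨i, Subtype.ext (by simpa using hi)⟩
  have h1 := (commutator_le_centralizer_of_isCyclic A).trans hCA
  rw [Subgroup.commutator_eq_bot_iff_le_centralizer]
  intro x hx
  rw [Subgroup.mem_centralizer_iff]
  intro y hy
  exact hAc y (h1 hy) x (h1 hx)

/-- A group of order `p ^ 3` has no derived subgroup of index `p`. -/
theorem index_commutator_ne_of_card_eq_prime_pow_three [Finite G] {p : ℕ} [hp : Fact p.Prime]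
    (hG : Nat.card G = p ^ 3) : (commutator G).index ≠ p := by
  intro hi
  have hP : IsPGroup p G := IsPGroup.of_card hG
  have hp1 := hp.out.one_lt
  -- The center is nontrivial, so its quotient has order at most p² and is abelian.
  have hcent : commutator G ≤ Subgroup.center G := by
    have hZ := hP.to_quotient (Subgroup.center G)
    have hnt : Nontrivial G := by
      rw [← Finite.one_lt_card_iff_nontrivial, hG]; exact Nat.one_lt_pow (by norm_num) hp1
    have hZ1 : Nat.card (Subgroup.center G) ≠ 1 := by
      rw [Ne, Subgroup.card_eq_one]; exact hP.bot_lt_center.ne'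
    obtain ⟨j, hj⟩ := IsPGroup.iff_card.1 hZ
    have hcard := Subgroup.card_eq_card_quotient_mul_card_subgroup (Subgroup.center G)
    have hcomm : ∀ a b : G ⧸ Subgroup.center G, a * b = b * a := by
      rcases Nat.lt_or_ge j 2 with h | h
      · have : IsCyclic (G ⧸ Subgroup.center G) := by
          interval_cases j
          · rw [pow_zero] at hj
            have := (Nat.card_eq_one_iff_unique.1 hj).1
            infer_instance
          · rw [pow_one] at hj
            exact isCyclic_of_prime_card hj
        exact fun a b => (IsCyclic.commGroup (α := G ⧸ Subgroup.center G)).mul_comm a b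
      · have : j = 2 := by
          obtain ⟨i, hZi⟩ := IsPGroup.iff_card.1 (hP.to_subgroup (Subgroup.center G))
          rw [hG, hj, hZi, ← pow_add] at hcard
          have h3 := Nat.pow_right_injective hp1 hcard
          have : i ≠ 0 := by rintro rfl; simp at hZi; exact hZ1 (by simp [hZi])
          omega
        subst this
        exact (IsPGroup.isMulCommutative_of_card_eq_prime_sq hj).is_comm.comm
    rw [commutator_def, Subgroup.commutator_le]
    intro a _ b _
    rw [← QuotientGroup.eq_one_iff]
    have := hcomm a b
    rw [commutatorElement_def, QuotientGroup.mk_mul, QuotientGroup.mk_mul, QuotientGroup.mk_mul,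
      QuotientGroup.mk_inv, QuotientGroup.mk_inv, this]
    group
  -- A cyclic quotient by a central subgroup makes G abelian, so the index would be p³.
  have hcyc : IsCyclic (G ⧸ commutator G) := isCyclic_of_prime_card (p := p) hi
  have hab := (MonoidHom.isMulCommutative_of_isCyclic_of_ker_le_center
    (QuotientGroup.mk' (commutator G)) (by rw [QuotientGroup.ker_mk']; exact hcent)).is_comm.comm
  have : commutator G = ⊥ := by
    rw [commutator_def, Subgroup.commutator_eq_bot_iff_le_centralizer]
    intro x _
    rw [Subgroup.mem_centralizer_iff]
    exact fun y _ => hab y x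
  rw [this, Subgroup.index_bot, hG] at hi
  have := Nat.pow_right_injective hp1 (hi.trans (pow_one p).symm)
  simp at this

end PGroups

/-! ### Intermediate subgroups and prime index. -/

section Between

variable {G : Type*} [Group G]

theorem card_lt_card_of_lt [Finite G] {H K : Subgroup G} (h : H < K) :
    Nat.card H < Nat.card K := by
  refine lt_of_le_of_ne (Subgroup.card_le_of_le h.le) fun he => h.ne ?_
  exact Subgroup.eq_of_le_of_card_ge h.le he.ge

theorem exists_between_card_prime_pow [Finite G] {p n m : ℕ} [Fact p.Prime] {N M : Subgroup G}
    (hNM : N ≤ M) (hN : Nat.card N = p ^ n) (hM : p ^ m ∣ Nat.card M) (hnm : n ≤ m) :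
    ∃ K : Subgroup G, N ≤ K ∧ K ≤ M ∧ Nat.card K = p ^ m := by
  obtain ⟨K, hK, hNK⟩ := Sylow.exists_subgroup_card_pow_prime_le p hM (N.subgroupOf M)
    (by rw [Nat.card_congr (Subgroup.subgroupOfEquivOfLe hNM).toEquiv, hN]) hnm
  refine ⟨K.map M.subtype, ?_, Subgroup.map_subtype_le K, ?_⟩
  · rw [← Subgroup.map_subgroupOf_eq_of_le hNM]
    exact Subgroup.map_mono hNK
  · rw [Subgroup.card_map_of_injective M.subtype_injective, hK]

theorem exists_between_or_prime_index [Finite G] (M : Subgroup G) [M.Normal] (hM : M ≠ ⊤) :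
    (∃ H, M < H ∧ H < ⊤) ∨ M.index.Prime := by
  have h1 : M.index ≠ 1 := by rwa [Ne, Subgroup.index_eq_one]
  obtain ⟨q, hq, hdvd⟩ := Nat.exists_prime_and_dvd h1
  have : Fact q.Prime := ⟨hq⟩
  obtain ⟨x, hx⟩ := exists_prime_orderOf_dvd_card' (G := G ⧸ M) q hdvd
  have hlt : M < (Subgroup.zpowers x).comap (QuotientGroup.mk' M) := by
    refine lt_of_le_of_ne (QuotientGroup.le_comap_mk' M _) fun he => ?_
    have h2 := Subgroup.map_comap_eq_self_of_surjective (QuotientGroup.mk'_surjective M)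
      (Subgroup.zpowers x)
    rw [← he, QuotientGroup.map_mk'_self] at h2
    have h3 := Subgroup.zpowers_eq_bot.1 h2.symm
    rw [h3, orderOf_one] at hx
    exact hq.one_lt.ne hx
  by_cases htop : (Subgroup.zpowers x).comap (QuotientGroup.mk' M) = ⊤
  · right
    have h2 := Subgroup.map_comap_eq_self_of_surjective (QuotientGroup.mk'_surjective M)
      (Subgroup.zpowers x)
    rw [htop, Subgroup.map_top_of_surjective _ (QuotientGroup.mk'_surjective M)] at h2
    have h3 := Nat.card_zpowers x
    rw [← h2, hx, Subgroup.card_top] at h3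
    rw [Subgroup.index, h3]; exact hq
  · exact Or.inl ⟨_, hlt, lt_top_iff_ne_top.2 htop⟩

theorem exists_between_or_prime_relIndex [Finite G] {N M : Subgroup G} [N.Normal] (h : N < M) :
    (∃ H, N < H ∧ H < M) ∨ (N.relIndex M).Prime := by
  rcases exists_between_or_prime_index (N.subgroupOf M)
    (by rw [Ne, Subgroup.subgroupOf_eq_top]; exact h.not_ge) with ⟨H, h1, h2⟩ | h1
  · left
    have hm : ∀ {A B : Subgroup M}, A < B → A.map M.subtype < B.map M.subtype :=
      fun h => Subgroup.map_subtype_lt_map_subtype.2 h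
    refine ⟨H.map M.subtype, ?_, ?_⟩
    · have := hm h1
      rwa [Subgroup.map_subgroupOf_eq_of_le h.le] at this
    · have := hm h2
      rwa [← MonoidHom.range_eq_map, Subgroup.range_subtype] at this
  · exact Or.inr h1

theorem commutator_subgroup_eq {M N : Subgroup G} (h : ⁅M, M⁆ = N) :
    commutator M = N.subgroupOf M := by
  apply Subgroup.map_injective M.subtype_injective
  rw [commutator_def, Subgroup.map_commutator, ← MonoidHom.range_eq_map, Subgroup.range_subtype, h,
    Subgroup.map_subgroupOf_eq_of_le]
  rw [← h]; exact Subgroup.commutator_le_self M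

end Between

/-! ### Derived length three: four classes, with M = G' and N = G''. -/

section DerivedLengthThree

variable {G : Type*} [Group G]

theorem card_zpowers_prime_ne_bot {x : G} {r : ℕ} (hr : r.Prime) (hx : orderOf x = r) :
    Subgroup.zpowers x ≠ ⊥ := by
  rw [Ne, Subgroup.zpowers_eq_bot]
  rintro rfl
  rw [orderOf_one] at hx
  exact hr.one_lt.ne hx

/-- Either two non-conjugate subgroups of order p² lie between N and M, or all of them form one
orbit. In the latter case counting forces p = 2 and index 3, and a subgroup of order 3 is the fourth
class. -/
theorem four_classes_of_card_eq_prime_pow_three [Finite G] {M N A : Subgroup G}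
    [M.Normal] [N.Normal] {p q : ℕ}
    (hp : p.Prime) (hq : q.Prime) (hN : Nat.card N = p) (hM : Nat.card M = p ^ 3)
    (hA : Nat.card A = p ^ 2) (hMi : M.index = q) (hNA : N < A) (hAM : A < M)
    (hAn : M ≤ Subgroup.normalizer (A : Set G))
    (hgood : ∀ H : Subgroup G, N < H → H < M → H ∈ nontrivialNonSelfNormalizing G)
    (hz : ∀ z ∈ M, z ∉ N → N < N ⊔ Subgroup.zpowers z ∧ N ⊔ Subgroup.zpowers z < M ∧
      Nat.card (N ⊔ Subgroup.zpowers z : Subgroup G) = p ^ 2)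
    (hMM : M ∈ nontrivialNonSelfNormalizing G) (hNN : N ∈ nontrivialNonSelfNormalizing G) :
    HasNonSelfNormalizingClasses G 4 := by
  classical
  have hNMl := hNA.trans hAM
  by_cases hO : ∃ z ∈ M, z ∉ N ∧
      MulAction.orbit (ConjAct G) A ≠ MulAction.orbit (ConjAct G) (N ⊔ Subgroup.zpowers z)
  · obtain ⟨z, hzM, hzN, hne⟩ := hO
    obtain ⟨h1, h2, h3⟩ := hz z hzM hzN
    exact .four hMM hNN (hgood A hNA hAM) (hgood _ h1 h2) (card_lt_card_of_lt hNMl).ne'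
      (card_lt_card_of_lt hAM).ne' (card_lt_card_of_lt hNA).ne (card_lt_card_of_lt h2).ne'
      (card_lt_card_of_lt h1).ne hne
  push Not at hO
  set O := MulAction.orbit (ConjAct G) A with hOdef
  have hOfin : O.Finite := Set.toFinite O
  have hOmem : ∀ B ∈ O, N ≤ B ∧ B ≤ M ∧ Nat.card B = p ^ 2 := by
    rintro _ ⟨g, rfl⟩
    refine ⟨?_, ?_, ?_⟩
    · have := (Subgroup.pointwise_smul_le_pointwise_smul_iff (a := g)).2 hNA.le
      rwa [conjAct_smul_eq_of_normal N g] at this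
    · have := (Subgroup.pointwise_smul_le_pointwise_smul_iff (a := g)).2 hAM.le
      rwa [conjAct_smul_eq_of_normal M g] at this
    · rw [← hA]; exact (Nat.card_congr (Subgroup.equivSMul g A).toEquiv).symm
  have heq : ∀ B ∈ O, ∀ z ∈ B, z ∉ N → B = N ⊔ Subgroup.zpowers z := by
    intro B hB z hzB hzN
    obtain ⟨h1, h2, h3⟩ := hOmem B hB
    refine (Subgroup.eq_of_le_of_card_ge ?_ ?_).symm
    · rw [sup_le_iff, Subgroup.zpowers_le]; exact ⟨h1, hzB⟩
    · rw [h3, (hz z (h2 hzB) hzN).2.2]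
  -- The conjugates of A partition M \ N, each contributing p² - p elements; since p³ - p = (p +
  -- 1)(p² - p), there are p + 1 of them.
  have hunion : ((M : Set G) \ N).toFinite.toFinset =
      hOfin.toFinset.biUnion fun B => ((B : Set G) \ N).toFinite.toFinset := by
    ext z
    simp only [Set.Finite.mem_toFinset, Finset.mem_biUnion, Set.mem_sdiff, SetLike.mem_coe]
    constructor
    · rintro ⟨h1, h2⟩
      refine ⟨N ⊔ Subgroup.zpowers z, ?_, le_sup_right (a := N) (Subgroup.mem_zpowers z), h2⟩
      rw [hO z h1 h2]; exact MulAction.mem_orbit_self _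
    · rintro ⟨B, hB, h1, h2⟩
      exact ⟨(hOmem B hB).2.1 h1, h2⟩
  have hsub : ∀ B : Subgroup G, N ≤ B →
      ((B : Set G) \ N).toFinite.toFinset.card = Nat.card B - p := by
    intro B hB
    rw [← Set.ncard_eq_toFinset_card, Set.ncard_sdiff hB, ← hN]
    rfl
  have hcount := congrArg Finset.card hunion
  rw [Finset.card_biUnion, hsub M hNMl.le, hM, Finset.sum_congr rfl
    (g := fun _ => p ^ 2 - p), Finset.sum_const, smul_eq_mul] at hcount
  rotate_left
  · intro B hB
    obtain ⟨h1, h2, h3⟩ := hOmem B (hOfin.mem_toFinset.1 hB)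
    rw [hsub B h1, h3]
  · intro B hB C hC hBC
    rw [Function.onFun, Finset.disjoint_left]
    intro z h1 h2
    simp only [Set.Finite.mem_toFinset, Set.mem_sdiff, SetLike.mem_coe] at h1 h2 hB hC
    exact hBC ((heq B hB z h1.1 h1.2).trans (heq C hC z h2.1 h2.2).symm)
  have hk : hOfin.toFinset.card = p + 1 := by
    have hp1 := hp.one_lt
    have h1 : p < p ^ 2 := by nlinarith
    have h2 : p ^ 3 - p = (p + 1) * (p ^ 2 - p) := by
      have h3 : p < p ^ 3 := by nlinarith
      zify [h1.le, h3.le]; ring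
    rw [h2] at hcount
    exact (Nat.eq_of_mul_eq_mul_right (Nat.sub_pos_of_lt h1) hcount).symm
  -- M normalizes A, so the orbit length divides the index of M.
  have hdvd : hOfin.toFinset.card ∣ q := by
    rw [← Set.ncard_eq_toFinset_card, hOdef, ← MulAction.index_stabilizer, ← hMi]
    let M' : Subgroup (ConjAct G) := M.map (ConjAct.toConjAct : G ≃* ConjAct G).toMonoidHom
    have hM' : M'.index = M.index :=
      Subgroup.index_map_of_bijective (ConjAct.toConjAct : G ≃* ConjAct G).bijective M
    rw [← hM']
    apply Subgroup.index_dvd_of_le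
    rintro _ ⟨m, hm, rfl⟩
    exact Subgroup.conjAct_pointwise_smul_eq_self (hAn hm)
  rw [hk] at hdvd
  have hqp : p + 1 = q := by
    rcases (Nat.dvd_prime hq).1 hdvd with h | h
    · have := hp.pos; omega
    · exact h
  have hp2 : p = 2 := by
    rcases hp.eq_two_or_odd' with h | h
    · exact h
    · rcases hq.eq_two_or_odd' with h' | h'
      · have := hp.one_lt; omega
      · rw [← hqp] at h'
        exact absurd h' (by simpa using h.add_one)
  subst hp2
  obtain rfl : q = 3 := hqp.symm
  have : Fact (Nat.Prime 3) := ⟨hq⟩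
  have h3 : 3 ∣ Nat.card G := hMi ▸ Subgroup.index_dvd_card M
  obtain ⟨c, hc⟩ := exists_prime_orderOf_dvd_card' 3 h3
  have hcc : Nat.card (Subgroup.zpowers c) = 3 := by rw [Nat.card_zpowers, hc]
  -- A normal subgroup of order 2 is central, so it normalizes ⟨c⟩.
  have hcent : ∀ n ∈ N, ∀ g : G, n * g = g * n := by
    intro n hn g
    obtain ⟨w, hw, huniq⟩ := (Nat.card_eq_two_iff' (1 : N)).1 hN
    by_cases h1 : n = 1
    · simp [h1]
    · have e1 := huniq ⟨n, hn⟩ (fun h => h1 (congrArg Subtype.val h))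
      have e2 := huniq ⟨g * n * g⁻¹, ‹N.Normal›.conj_mem n hn g⟩ (fun h => h1 (by
        have := congrArg Subtype.val h
        simpa using this))
      have := congrArg Subtype.val (e1.trans e2.symm)
      simp only at this
      rw [eq_mul_inv_iff_mul_eq] at this
      exact this
  have hD : Subgroup.zpowers c ∈ nontrivialNonSelfNormalizing G := by
    refine mem_of_not_le (card_zpowers_prime_ne_bot hq hc) (K := N) ?_
      (le_normalizer_of_forall_commute fun n hn x _ => hcent n hn x)
    intro hle
    have := Subgroup.card_dvd_of_le hle
    rw [hN, hcc] at this
    omega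
  refine .four hMM hNN (hgood A hNA hAM) hD (card_lt_card_of_lt hNMl).ne'
      (card_lt_card_of_lt hAM).ne' (card_lt_card_of_lt hNA).ne ?_ ?_ (orbit_ne_of_card_ne ?_)
  · rw [hM, hcc]; norm_num
  · rw [hN, hcc]; norm_num
  · rw [hA, hcc]; norm_num

theorem normal_of_commutator_le_of {H : Subgroup G} (h : commutator G ≤ H) : H.Normal := by
  rw [← Subgroup.normalizer_eq_top_iff, ← top_le_iff]
  exact normalizer_of_commutator_le le_top h

/-- N is cyclic, hence central in M, and every subgroup between N and M is normalized by M. A fourth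
class comes from a second prime dividing |M|, or from the chain of p-power orders; order p³ is the
exceptional case. -/
theorem four_classes_of_prime_card [Finite G] {M N : Subgroup G} [M.Normal] [N.Normal]
    (hGM : commutator G = M) (hMN : ⁅M, M⁆ = N) (hM : M ≠ ⊤) (hlt : N < M) (hN : N ≠ ⊥) {p : ℕ}
    (hp : p.Prime) (hNp : Nat.card N = p) : HasNonSelfNormalizingClasses G 4 := by
  have : Fact p.Prime := ⟨hp⟩
  have hM0 : M ≠ ⊥ := fun h => hN (le_bot_iff.1 (h ▸ hlt.le))
  have hNT : N ≠ ⊤ := (hlt.trans_le le_top).ne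
  have hMM := mem_of_normal hM0 hM
  have hNN := mem_of_normal hN hNT
  have hcyc : IsCyclic N := isCyclic_of_prime_card hNp
  have hNc : ∀ m ∈ M, ∀ n ∈ N, n * m = m * n := by
    intro m hm n hn
    rw [← hGM] at hm
    exact Subgroup.mem_centralizer_iff.1 (commutator_le_centralizer_of_isCyclic N hm) n hn
  have hAn : ∀ H : Subgroup G, N ≤ H → H ≤ M → M ≤ Subgroup.normalizer (H : Set G) :=
    fun H h1 h2 => normalizer_of_commutator_le h2 (hMN.trans_le h1)
  have hgood : ∀ H : Subgroup G, N < H → H < M → H ∈ nontrivialNonSelfNormalizing G :=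
    fun H h1 h2 => mem_of_not_le (bot_le.trans_lt h1).ne' h2.not_ge (hAn H h1.le h2.le)
  have hz : ∀ z ∈ M, z ∉ N → N < N ⊔ Subgroup.zpowers z ∧ N ⊔ Subgroup.zpowers z < M := by
    intro z hzM hzN
    constructor
    · rw [left_lt_sup, Subgroup.zpowers_le]; exact hzN
    -- N⟨z⟩ is abelian because N is central in M, whereas M is not.
    · refine lt_of_le_of_ne (sup_le hlt.le (Subgroup.zpowers_le.2 hzM)) fun he => ?_
      have h1 := sup_zpowers_le_centralizer (A := N) (c := z)
        (fun x hx y hy => hNc y (hlt.le hy) x hx) (hNc z hzM)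
      rw [he, ← Subgroup.commutator_eq_bot_iff_le_centralizer, hMN] at h1
      exact hN h1
  obtain ⟨x, hxM, hxN⟩ := SetLike.exists_of_lt hlt
  obtain ⟨hNA, hAM⟩ := hz x hxM hxN
  set A := N ⊔ Subgroup.zpowers x with hA
  have hcNM := card_lt_card_of_lt hlt
  have hcNA := card_lt_card_of_lt hNA
  have hcAM := card_lt_card_of_lt hAM
  by_cases hr : ∃ r : ℕ, r.Prime ∧ r ∣ Nat.card M ∧ r ≠ p
  · obtain ⟨r, hr, hrM, hrp⟩ := hr
    have : Fact r.Prime := ⟨hr⟩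
    obtain ⟨y, hy⟩ := exists_prime_orderOf_dvd_card' r hrM
    rw [← Subgroup.orderOf_coe] at hy
    have hyc : Nat.card (Subgroup.zpowers (y : G)) = r := by rw [Nat.card_zpowers, hy]
    have hne : ∀ H : Subgroup G, N ≤ H → Nat.card H ≠ r := by
      intro H hH he
      have := Subgroup.card_dvd_of_le hH
      rw [he, hNp, Nat.prime_dvd_prime_iff_eq hp hr] at this
      exact hrp this.symm
    have hD : Subgroup.zpowers (y : G) ∈ nontrivialNonSelfNormalizing G := by
      refine mem_of_not_le (card_zpowers_prime_ne_bot hr hy) (K := N) (fun h => hne _ h hyc)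
        (le_normalizer_of_forall_commute fun n hn z hz => hNc z ?_ n hn)
      exact Subgroup.zpowers_le.2 y.2 hz
    exact .four hMM hNN (hgood A hNA hAM) hD hcNM.ne' hcAM.ne' hcNA.ne
      (hyc ▸ hne M hlt.le) (hyc ▸ hne N le_rfl) (orbit_ne_of_card_ne (hyc ▸ hne A hNA.le))
  push Not at hr
  have hMk := Nat.eq_prime_pow_of_unique_prime_dvd (n := Nat.card M) (p := p) Nat.card_pos.ne'
    (fun {d} hd hdM => hr d hd hdM)
  set k := (Nat.card M).primeFactorsList.length
  have hp1 := hp.one_lt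
  have hmid : ∀ H : Subgroup G, N < H → H < M → ∃ j, 1 < j ∧ j < k ∧ Nat.card H = p ^ j := by
    intro H h1 h2
    have hd := Subgroup.card_dvd_of_le h2.le
    rw [hMk] at hd
    obtain ⟨j, -, hj⟩ := (Nat.dvd_prime_pow hp).1 hd
    have c1 := card_lt_card_of_lt h1
    have c2 := card_lt_card_of_lt h2
    rw [hj, hNp] at c1
    rw [hj, hMk] at c2
    refine ⟨j, ?_, (Nat.pow_lt_pow_iff_right hp1).1 c2, hj⟩
    rw [← Nat.pow_lt_pow_iff_right hp1, pow_one]; exact c1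
  obtain ⟨j, hj1, hjk, hjA⟩ := hmid A hNA hAM
  by_cases hk3 : k = 3
  · rw [hk3] at hMk hmid
    have hsq : ∀ H : Subgroup G, N < H → H < M → Nat.card H = p ^ 2 := by
      intro H h1 h2
      obtain ⟨j, hj1, hj2, hj⟩ := hmid H h1 h2
      obtain rfl : j = 2 := by omega
      exact hj
    rcases exists_between_or_prime_index M hM with ⟨H, h1, h2⟩ | hq
    · have : H.Normal := normal_of_commutator_le_of (hGM.trans_le h1.le)
      have hcMH := card_lt_card_of_lt h1
      exact .four hMM hNN (hgood A hNA hAM) (mem_of_normal (bot_le.trans_lt h1).ne' h2.ne) hcNM.ne'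
        hcAM.ne' hcNA.ne hcMH.ne (hcNM.trans hcMH).ne (orbit_ne_of_card_ne (hcAM.trans hcMH).ne)
    · exact four_classes_of_card_eq_prime_pow_three hp hq hNp hMk (hsq A hNA hAM) rfl hNA hAM
        (hAn A hNA.le hAM.le) hgood
        (fun z h1 h2 => ⟨(hz z h1 h2).1, (hz z h1 h2).2, hsq _ (hz z h1 h2).1 (hz z h1 h2).2⟩)
        hMM hNN
  -- The order of A already gives k ≥ 3, so here k ≥ 4 and both p² and p³ occur strictly between N
  -- and M.
  · have hex : ∀ i, 1 < i → i < k → ∃ K : Subgroup G, N < K ∧ K < M ∧ Nat.card K = p ^ i := by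
      intro i h1 h2
      obtain ⟨K, hNK, hKM, hK⟩ := exists_between_card_prime_pow (p := p) (n := 1) (m := i) hlt.le
        (by rw [hNp, pow_one]) (by rw [hMk]; exact pow_dvd_pow p h2.le) h1.le
      refine ⟨K, lt_of_le_of_ne hNK ?_, lt_of_le_of_ne hKM ?_, hK⟩
      · rintro rfl
        rw [hNp] at hK
        have := Nat.pow_right_injective hp1 ((pow_one p).trans hK)
        omega
      · rintro rfl
        rw [hMk] at hK
        exact h2.ne' (Nat.pow_right_injective hp1 hK)
    obtain ⟨B, hNB, hBM, hB⟩ := hex 2 (by omega) (by omega)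
    obtain ⟨C, hNC, hCM, hC⟩ := hex 3 (by omega) (by omega)
    refine .four hMM hNN (hgood B hNB hBM) (hgood C hNC hCM) hcNM.ne'
      (card_lt_card_of_lt hBM).ne' (card_lt_card_of_lt hNB).ne
      (card_lt_card_of_lt hCM).ne' (card_lt_card_of_lt hNC).ne (orbit_ne_of_card_ne ?_)
    rw [hB, hC]
    exact (Nat.pow_lt_pow_right hp1 (by norm_num)).ne

/-- N is abelian, so its proper nontrivial subgroups all count; one of prime order is the third
class. The fourth lies in N unless |N| = p², and then it is found between N and M or as a Sylow
subgroup of M. -/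
theorem four_classes_of_not_prime_card [Finite G] {M N : Subgroup G} [M.Normal] [N.Normal]
    (hMN : ⁅M, M⁆ = N) (hNab : ⁅N, N⁆ = ⊥) (hM : M ≠ ⊤) (hlt : N < M)
    (hN : N ≠ ⊥) (hNp : ¬ (Nat.card N).Prime) : HasNonSelfNormalizingClasses G 4 := by
  have hM0 : M ≠ ⊥ := fun h => hN (le_bot_iff.1 (h ▸ hlt.le))
  have hMM := mem_of_normal hM0 hM
  have hNN := mem_of_normal hN (hlt.trans_le le_top).ne
  have hcNM := card_lt_card_of_lt hlt
  have hN1 : Nat.card N ≠ 1 := by rwa [Ne, Subgroup.card_eq_one]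
  have hgoodN : ∀ H : Subgroup G, H ≠ ⊥ → H < N → H ∈ nontrivialNonSelfNormalizing G :=
    fun H h1 h2 => mem_of_not_le h1 h2.not_ge
      (normalizer_of_commutator_le h2.le (hNab.trans_le bot_le))
  have hord : ∀ r : ℕ, r.Prime → r ∣ Nat.card N → ∃ B : Subgroup G, B ≠ ⊥ ∧ B < N ∧
      Nat.card B = r := by
    intro r hr hd
    have : Fact r.Prime := ⟨hr⟩
    obtain ⟨y, hy⟩ := exists_prime_orderOf_dvd_card' r hd
    rw [← Subgroup.orderOf_coe] at hy
    have hyc : Nat.card (Subgroup.zpowers (y : G)) = r := by rw [Nat.card_zpowers, hy]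
    refine ⟨Subgroup.zpowers (y : G), card_zpowers_prime_ne_bot hr hy,
      lt_of_le_of_ne (Subgroup.zpowers_le.2 y.2) ?_, hyc⟩
    intro he
    rw [he] at hyc
    exact hNp (hyc ▸ hr)
  obtain ⟨p, hp, hpN⟩ := Nat.exists_prime_and_dvd hN1
  have hfp : Fact p.Prime := ⟨hp⟩
  have hp1 := hp.one_lt
  obtain ⟨B, hB0, hBN, hBc⟩ := hord p hp hpN
  have hBgood := hgoodN B hB0 hBN
  have hcBN := card_lt_card_of_lt hBN
  by_cases hr : ∃ r : ℕ, r.Prime ∧ r ∣ Nat.card N ∧ r ≠ p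
  · obtain ⟨r, hr, hrN, hrp⟩ := hr
    obtain ⟨D, hD0, hDN, hDc⟩ := hord r hr hrN
    have hcDN := card_lt_card_of_lt hDN
    exact .four hMM hNN hBgood (hgoodN D hD0 hDN) hcNM.ne' (hcBN.trans hcNM).ne' hcBN.ne'
      (hcDN.trans hcNM).ne' hcDN.ne' (orbit_ne_of_card_ne (by rw [hBc, hDc]; exact hrp.symm))
  push Not at hr
  have hNk := Nat.eq_prime_pow_of_unique_prime_dvd (n := Nat.card N) (p := p) Nat.card_pos.ne'
    (fun {d} hd hdM => hr d hd hdM)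
  set k := (Nat.card N).primeFactorsList.length
  have hk0 : k ≠ 0 := by intro h; rw [h, pow_zero] at hNk; exact hN1 hNk
  have hk1 : k ≠ 1 := by intro h; rw [h, pow_one] at hNk; exact hNp (hNk ▸ hp)
  by_cases hk2 : k = 2
  swap
  · obtain ⟨D, hBD, hDN, hD⟩ := exists_between_card_prime_pow (p := p) (n := 1) (m := 2) hBN.le
      (by rw [hBc, pow_one]) (by rw [hNk]; exact pow_dvd_pow p (by omega)) (by norm_num)
    have hDN' : D < N := by
      refine lt_of_le_of_ne hDN ?_
      rintro rfl
      rw [hNk] at hD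
      exact hk2 (Nat.pow_right_injective hp1 hD)
    have hBD' : B < D := by
      refine lt_of_le_of_ne hBD ?_
      rintro rfl
      rw [hBc] at hD
      have := Nat.pow_right_injective hp1 ((pow_one p).trans hD)
      omega
    have hcDN := card_lt_card_of_lt hDN'
    exact .four hMM hNN hBgood (hgoodN D (bot_le.trans_lt hBD').ne' hDN') hcNM.ne'
      (hcBN.trans hcNM).ne' hcBN.ne' (hcDN.trans hcNM).ne' hcDN.ne'
      (orbit_ne_of_card_ne (card_lt_card_of_lt hBD').ne)
  rw [hk2] at hNk
  rcases exists_between_or_prime_relIndex hlt with ⟨D, hND, hDM⟩ | hq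
  · have hcND := card_lt_card_of_lt hND
    have hcDM := card_lt_card_of_lt hDM
    exact .four hMM hNN hBgood (mem_of_not_le (bot_le.trans_lt hND).ne' hDM.not_ge
      (normalizer_of_commutator_le hDM.le (hMN.trans_le hND.le))) hcNM.ne'
      (hcBN.trans hcNM).ne' hcBN.ne' hcDM.ne' hcND.ne (orbit_ne_of_card_ne (hcBN.trans hcND).ne)
  set q := N.relIndex M with hqdef
  have hfq : Fact q.Prime := ⟨hq⟩
  have hMc : Nat.card M = p ^ 2 * q := by
    have := Subgroup.relIndex_mul_relIndex ⊥ N M bot_le hlt.le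
    rw [Subgroup.relIndex_bot_left, Subgroup.relIndex_bot_left, hNk] at this
    exact this.symm
  by_cases hqp : q = p
  · exfalso
    rw [hqp] at hMc
    refine index_commutator_ne_of_card_eq_prime_pow_three (G := M) (p := p)
      (by rw [hMc, ← pow_succ]) ?_
    rw [commutator_subgroup_eq hMN]
    exact hqp
  · obtain ⟨Q⟩ : Nonempty (Sylow q M) := inferInstance
    have hQc : Nat.card (Q.map M.subtype : Subgroup G) = q := by
      rw [Subgroup.card_map_of_injective M.subtype_injective]
      have := Q.card_eq_multiplicity
      rw [hMc, Nat.factorization_mul (pow_ne_zero _ hp.ne_zero) hq.ne_zero, hp.factorization_pow,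
        hq.factorization] at this
      simpa [Finsupp.single_apply, Ne.symm hqp] using this
    have hQM : Q.map M.subtype ≤ M := Subgroup.map_subtype_le _
    have hQ : Q.map M.subtype ∈ nontrivialNonSelfNormalizing G := by
      refine ⟨fun h => ?_, fun h => ?_⟩
      · rw [h, Subgroup.card_bot] at hQc; exact hq.one_lt.ne hQc
      -- Frattini argument: the normalizer of Q together with M generates G, so a self-normalizing Q
      -- ≤ M would force M = G.
      · have := Q.normalizer_sup_eq_top
        rw [h, sup_eq_right.2 hQM] at this
        exact hM this
    refine .four hMM hNN hBgood hQ hcNM.ne' (hcBN.trans hcNM).ne' hcBN.ne' ?_ ?_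
      (orbit_ne_of_card_ne ?_)
    · rw [hQc, hMc]
      have := hq.pos
      nlinarith
    · rw [hQc, hNk]
      intro h
      exact hqp ((Nat.prime_dvd_prime_iff_eq hq hp).1 (hq.dvd_of_dvd_pow h.symm.dvd))
    · rw [hQc, hBc]; exact Ne.symm hqp

end DerivedLengthThree

/-! ### Induction on the derived length. -/

section DerivedLength

variable {G : Type*} [Group G]

theorem derivedSeries_succ_lt [Group.IsSolvable G] {n : ℕ} (h : derivedSeries G n ≠ ⊥) :
    derivedSeries G (n + 1) < derivedSeries G n :=
  Group.IsSolvable.commutator_lt_of_ne_bot h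

theorem four_classes_of_derivedSeries [Finite G] [Group.IsSolvable G] (h2 : derivedSeries G 2 ≠ ⊥)
    (h3 : derivedSeries G 3 = ⊥) : HasNonSelfNormalizingClasses G 4 := by
  have h1 : derivedSeries G 1 ≠ ⊥ := fun h =>
    h2 (le_bot_iff.1 (h ▸ derivedSeries_antitone (G := G) (show 1 ≤ 2 by norm_num)))
  have h0 : derivedSeries G 0 ≠ ⊥ := fun h =>
    h1 (le_bot_iff.1 (h ▸ derivedSeries_antitone (G := G) (show 0 ≤ 1 by norm_num)))
  have hM : derivedSeries G 1 ≠ ⊤ := (derivedSeries_succ_lt h0).ne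
  by_cases hp : (Nat.card (derivedSeries G 2)).Prime
  · exact four_classes_of_prime_card (derivedSeries_one (G := G)).symm rfl hM (derivedSeries_succ_lt h1)
      h2 hp rfl
  · exact four_classes_of_not_prime_card (M := derivedSeries G 1) rfl h3 hM (derivedSeries_succ_lt h1)
      h2 hp

theorem exists_mem_not_le_of_derivedSeries [Finite G] (h3 : derivedSeries G 3 ≠ ⊥)
    (h4 : derivedSeries G 4 = ⊥) :
    ∃ H ∈ nontrivialNonSelfNormalizing G, ¬ derivedSeries G 3 ≤ H := by
  set N := derivedSeries G 3 with hNdef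
  have hN1 : Nat.card N ≠ 1 := by rwa [Ne, Subgroup.card_eq_one]
  obtain ⟨p, hp, hpN⟩ := Nat.exists_prime_and_dvd hN1
  have : Fact p.Prime := ⟨hp⟩
  obtain ⟨b, hb⟩ := exists_prime_orderOf_dvd_card' p hpN
  rw [← Subgroup.orderOf_coe] at hb
  by_cases hle : N ≤ Subgroup.zpowers (b : G)
  swap
  · refine ⟨_, mem_of_not_le (card_zpowers_prime_ne_bot hp hb) hle ?_, hle⟩
    exact normalizer_of_commutator_le (Subgroup.zpowers_le.2 b.2) (h4.trans_le bot_le)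
  have hNb : N = Subgroup.zpowers (b : G) := le_antisymm hle (Subgroup.zpowers_le.2 b.2)
  have hNc : Nat.card N = p := by rw [hNb, Nat.card_zpowers, hb]
  have hcyc : IsCyclic N := isCyclic_of_prime_card hNc
  by_contra hcon
  push Not at hcon
  set M := derivedSeries G 1 with hM
  have hcent : ∀ m ∈ M, ∀ n ∈ N, n * m = m * n := by
    intro m hm n hn
    rw [hM, derivedSeries_one] at hm
    exact Subgroup.mem_centralizer_iff.1 (commutator_le_centralizer_of_isCyclic N hm) n hn
  -- N centralizes ⟨x⟩; if N were not inside ⟨x⟩, then ⟨x⟩ would be the excluded kind of subgroup.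
  -- So N is the only subgroup of prime order in M.
  have hkey : ∀ x : M, ∀ r : ℕ, r.Prime → orderOf x = r → N = Subgroup.zpowers (x : G) := by
    intro x r hr hx
    rw [← Subgroup.orderOf_coe] at hx
    have hc : Nat.card (Subgroup.zpowers (x : G)) = r := by rw [Nat.card_zpowers, hx]
    have h1 : N ≤ Subgroup.zpowers (x : G) := by
      by_contra hn
      refine hn (hcon _ (mem_of_not_le (card_zpowers_prime_ne_bot hr hx) hn
        (le_normalizer_of_forall_commute fun n hn z hz => hcent z ?_ n hn)))
      exact Subgroup.zpowers_le.2 x.2 hz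
    refine Subgroup.eq_of_le_of_card_ge h1 ?_
    have h2 := Subgroup.card_dvd_of_le h1
    rw [hNc, hc, Nat.prime_dvd_prime_iff_eq hp hr] at h2
    rw [hc, hNc, h2]
  have hMP : IsPGroup p M := by
    refine IsPGroup.of_card (Nat.eq_prime_pow_of_unique_prime_dvd Nat.card_pos.ne' ?_)
    intro r hr hrM
    have : Fact r.Prime := ⟨hr⟩
    obtain ⟨y, hy⟩ := exists_prime_orderOf_dvd_card' r hrM
    rw [← hNc, hkey y r hr hy, Nat.card_zpowers, Subgroup.orderOf_coe, hy]
  have h5 := hMP.commutator_comm_of_unique_order_prime (fun x y hx hy => by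
    have h6 : (x : G) ∈ Subgroup.zpowers (y : G) := by
      rw [← hkey y p hp hy, hkey x p hp hx]; exact Subgroup.mem_zpowers _
    obtain ⟨i, hi⟩ := Subgroup.mem_zpowers_iff.1 h6
    exact Subgroup.mem_zpowers_iff.2 ⟨i, Subtype.ext (by simpa using hi)⟩)
  apply h3
  have h7 := congrArg (Subgroup.map M.subtype) h5
  rw [Subgroup.map_commutator, commutator_def, Subgroup.map_commutator, ← MonoidHom.range_eq_map,
    Subgroup.range_subtype, Subgroup.map_bot] at h7
  exact h7

theorem hasNonSelfNormalizingClasses_of_derivedSeries (k : ℕ) :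
    ∀ (G : Type*) [Group G] [Finite G] [Group.IsSolvable G], derivedSeries G (k + 3) ≠ ⊥ →
      derivedSeries G (k + 4) = ⊥ → HasNonSelfNormalizingClasses G (k + 6) := by
  have hquot : ∀ (j : ℕ) (G : Type _) [Group G] [Finite G] [Group.IsSolvable G],
      derivedSeries G (j + 1) ≠ ⊥ → derivedSeries G (j + 1) ≠ ⊤ ∧
      derivedSeries (G ⧸ derivedSeries G (j + 1)) j ≠ ⊥ ∧
      derivedSeries (G ⧸ derivedSeries G (j + 1)) (j + 1) = ⊥ := by
    intro j G _ _ _ h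
    have hs := QuotientGroup.mk'_surjective (derivedSeries G (j + 1))
    have h0 : derivedSeries G j ≠ ⊥ := fun h' =>
      h (le_bot_iff.1 (h' ▸ derivedSeries_antitone (G := G) (Nat.le_succ j)))
    have hlt := derivedSeries_succ_lt h0
    refine ⟨(hlt.trans_le le_top).ne, ?_, ?_⟩
    · rw [← map_derivedSeries_eq hs, Ne, Subgroup.map_eq_bot_iff, QuotientGroup.ker_mk']
      exact hlt.not_ge
    · rw [← map_derivedSeries_eq hs, Subgroup.map_eq_bot_iff, QuotientGroup.ker_mk']
  induction k with
  | zero =>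
    intro G _ _ _ h3 h4
    obtain ⟨h5, h6, h7⟩ := hquot 2 G h3
    exact (HasNonSelfNormalizingClasses.of_quotient (four_classes_of_derivedSeries h6 h7) h3 h5).2
      (exists_mem_not_le_of_derivedSeries h3 h4)
  | succ k ih =>
    intro G _ _ _ h3 h4
    obtain ⟨h5, h6, h7⟩ := hquot (k + 3) G (by rwa [add_right_comm] at h3)
    have := (HasNonSelfNormalizingClasses.of_quotient (ih _ h6 h7)
      (by rwa [add_right_comm] at h3) h5).1
    rwa [add_right_comm k 6 1] at this

end DerivedLength

theorem mainTheorem3 (n : ℕ) (hn : 5 ≤ n) (G : Type*) [Group G]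
    (hG : FamilyD n G) (hsolv : Group.IsSolvable G) :
    derivedLength G ≤ n - 2 := by
  obtain ⟨hfin, hnum⟩ := hG
  have hmem : derivedSeries G (derivedLength G) = ⊥ :=
    Nat.sInf_mem (s := {k : ℕ | derivedSeries G k = ⊥}) hsolv.solvable
  by_contra hlt
  push Not at hlt
  -- Here n ≥ 5 enters: exceeding n - 2 ≥ 3 puts the derived length at 4 or more, where the k + 6
  -- bound is available.
  obtain ⟨k, hk⟩ : ∃ k, derivedLength G = k + 4 := ⟨derivedLength G - 4, by omega⟩
  have hne : derivedSeries G (k + 3) ≠ ⊥ := by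
    intro h
    have : derivedLength G ≤ k + 3 := Nat.sInf_le h
    omega
  have := (hasNonSelfNormalizingClasses_of_derivedSeries k G hne (hk ▸ hmem)).le_num
  omega
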